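/- For $s\in\mathbb{R}$ and $n\ge 1$ let $h_s(n)=n^s$. Define polynomials by $P_0^{h_s}(x)=1$ and $P_n^{h_s}(x)=\frac{x}{h_s(n)}\sum_{k=0}^{n-1}P_k^{h_s}(x)$ for $n\ge 1$, and let $A_{n,k}(s)$ be their coefficients: $P_n^{h_s}(x)=\sum_{k=0}^n A_{n,k}(s)\,x^k$. Put $$\mu_n(s)=1+\sum_{k=1}^{n-1}\frac{1}{1+k^s},\qquad \sigma_n(s)=\Bigl(\sum_{k=1}^{n-1}\frac{k^s}{(1+k^s)^2}\Bigr)^{1/2}.$$ Then there is a constant $C>0$ such that for all $s\in[0,1]$ and all $n\ge 2$ $$\sup_{x\in\mathbb{R}}\left|\frac{1}{P_n^{h_s}(1)}\sum_{k\le \mu_n(s)+x\,\sigma_n(s)}A_{n,k}(s)-\frac{1}{\sqrt{2\pi}}\int_{-\infty}^x e^{-t^2/2}\,dt\right|\le \frac{C}{\sigma_n(s)},$$ where the sum runs over those $k\in\{0,\dots,n\}$ with $k\le\mu_n(s)+x\,\sigma_n(s)$. Moreover, for every $s\in[0,1]$, $\sigma_n(s)\to\infty$ as $n\to\infty$. 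-/

import Mathlib

/-- The arithmetic function `h_s(n) = n ^ s`. -/
noncomputable def hPow (s : ℝ) (n : ℕ) : ℝ := (n : ℝ) ^ s

/-- The polynomials `P_n^h`, given by `P_0^h = 1` and
`P_n^h(x) = x / h(n) * ∑_{k = 0}^{n - 1} P_k^h(x)` for `n ≥ 1`. -/
noncomputable def polyP (h : ℕ → ℝ) : ℕ → Polynomial ℝ
  | 0 => 1
  | n + 1 => Polynomial.C (1 / h (n + 1)) * Polynomial.X * ∑ k : Fin (n + 1), polyP h k

/-- The coefficients `A_{n,k}(s)` of `P_n^{h_s}`. -/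
noncomputable def coeffA (s : ℝ) (n k : ℕ) : ℝ := (polyP (hPow s) n).coeff k

/-- `μ_n(s) = 1 + ∑_{k = 1}^{n - 1} 1 / (1 + k ^ s)`. -/
noncomputable def muN (s : ℝ) (n : ℕ) : ℝ :=
  1 + ∑ k ∈ Finset.Ico 1 n, 1 / (1 + (k : ℝ) ^ s)

/-- `σ_n(s)`, the non-negative square root of `∑_{k = 1}^{n - 1} k ^ s / (1 + k ^ s) ^ 2`. -/
noncomputable def sigmaN (s : ℝ) (n : ℕ) : ℝ :=
  Real.sqrt (∑ k ∈ Finset.Ico 1 n, (k : ℝ) ^ s / (1 + (k : ℝ) ^ s) ^ 2)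

/-- The unnormalised Gaussian distribution function. -/
noncomputable def gaussInt (x : ℝ) : ℝ := ∫ t in Set.Iic x, Real.exp (-t ^ 2 / 2)

lemma integrable_gauss : MeasureTheory.Integrable (fun t : ℝ => Real.exp (-t ^ 2 / 2)) := by
  have h := integrable_exp_neg_mul_sq (b := 1 / 2) (by norm_num)
  refine h.congr (Filter.Eventually.of_forall fun t => ?_)
  simp only
  congr 1
  ring

lemma integral_gauss : ∫ t : ℝ, Real.exp (-t ^ 2 / 2) = Real.sqrt (2 * Real.pi) := by
  have h := integral_gaussian (1 / 2)
  rw [show Real.pi / (1 / 2) = 2 * Real.pi by ring] at h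
  rw [← h]
  congr 1
  ext t
  congr 1
  ring

lemma one_le_sqrt_two_pi : 1 ≤ Real.sqrt (2 * Real.pi) := by
  rw [Real.one_le_sqrt]
  linarith [Real.pi_gt_three]

lemma gaussInt_nonneg (x : ℝ) : 0 ≤ gaussInt x :=
  MeasureTheory.integral_nonneg fun _ => (Real.exp_pos _).le

lemma gaussInt_add_tail (x : ℝ) :
    gaussInt x + ∫ t in Set.Ioi x, Real.exp (-t ^ 2 / 2) = Real.sqrt (2 * Real.pi) := by
  rw [← integral_gauss, gaussInt, ← Set.compl_Iic]
  exact MeasureTheory.integral_add_compl measurableSet_Iic integrable_gauss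

lemma gaussInt_neg (x : ℝ) : gaussInt (-x) = Real.sqrt (2 * Real.pi) - gaussInt x := by
  have h := integral_comp_neg_Iic (-x) (fun t : ℝ => Real.exp (-t ^ 2 / 2))
  simp only [neg_sq, neg_neg] at h
  rw [← gaussInt_add_tail x, ← h, gaussInt, gaussInt]
  ring

lemma gaussInt_le (x : ℝ) : gaussInt x ≤ Real.sqrt (2 * Real.pi) := by
  linarith [gaussInt_neg x, gaussInt_nonneg (-x)]

lemma hasDerivAt_gaussInt (x : ℝ) : HasDerivAt gaussInt (Real.exp (-x ^ 2 / 2)) x := by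
  have hc : Continuous (fun t : ℝ => Real.exp (-t ^ 2 / 2)) := by fun_prop
  have h : ∀ y, gaussInt y = gaussInt 0 + ∫ t in (0 : ℝ)..y, Real.exp (-t ^ 2 / 2) := fun y => by
    rw [gaussInt, gaussInt, ← intervalIntegral.integral_Iic_sub_Iic integrable_gauss.integrableOn
      integrable_gauss.integrableOn]
    ring
  rw [funext h]
  exact (intervalIntegral.integral_hasDerivAt_right (hc.intervalIntegrable _ _)
    (hc.stronglyMeasurableAtFilter _ _) hc.continuousAt).const_add _

lemma gaussInt_sub_le {x y : ℝ} (h : x ≤ y) : gaussInt y - gaussInt x ≤ y - x := by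
  have := Convex.image_sub_le_mul_sub_of_deriv_le (convex_univ (𝕜 := ℝ) (E := ℝ)) (f := gaussInt)
    (fun z _ => (hasDerivAt_gaussInt z).continuousAt.continuousWithinAt)
    (fun z _ => (hasDerivAt_gaussInt z).differentiableAt.differentiableWithinAt) (C := 1)
    (fun z _ => by
      rw [(hasDerivAt_gaussInt z).deriv]
      exact Real.exp_le_one_iff.2 (by nlinarith [sq_nonneg z])) x trivial y trivial h
  linarith

lemma gaussInt_mono : Monotone gaussInt :=
  monotone_of_deriv_nonneg (fun z => (hasDerivAt_gaussInt z).differentiableAt)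
    fun z => by rw [(hasDerivAt_gaussInt z).deriv]; positivity

lemma gauss_tail_mul_le {w : ℝ} (hw : 0 < w) :
    w * (Real.sqrt (2 * Real.pi) - gaussInt w) ≤ Real.exp (-w ^ 2 / 2) := by
  have hd : ∀ t : ℝ, HasDerivAt (fun t : ℝ => -Real.exp (-t ^ 2 / 2))
      (t * Real.exp (-t ^ 2 / 2)) t := fun t => by
    have := (((hasDerivAt_pow 2 t).neg.div_const 2).exp).neg
    refine this.congr_deriv ?_
    simp only [Pi.neg_apply, Nat.cast_ofNat, Nat.add_one_sub_one, pow_one]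
    ring
  have hl : Filter.Tendsto (fun t : ℝ => -Real.exp (-t ^ 2 / 2)) Filter.atTop (nhds 0) := by
    rw [← neg_zero]
    refine (Real.tendsto_exp_atBot.comp ?_).neg
    have : Filter.Tendsto (fun t : ℝ => t ^ 2 / 2) Filter.atTop Filter.atTop :=
      (Filter.tendsto_pow_atTop two_ne_zero).atTop_div_const two_pos
    exact (Filter.tendsto_neg_atTop_atBot.comp this).congr fun t => by simp [neg_div]
  have hi := MeasureTheory.integrableOn_Ioi_deriv_of_nonneg' (a := w) (fun t _ => hd t)
    (fun t ht => mul_nonneg (hw.trans ht).le (Real.exp_pos _).le) hl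
  have hv := MeasureTheory.integral_Ioi_of_hasDerivAt_of_tendsto' (a := w) (fun t _ => hd t) hi hl
  have h1 : w * (Real.sqrt (2 * Real.pi) - gaussInt w)
      = ∫ t in Set.Ioi w, w * Real.exp (-t ^ 2 / 2) := by
    rw [← gaussInt_add_tail w, MeasureTheory.integral_const_mul]
    ring
  rw [h1, show Real.exp (-w ^ 2 / 2) = 0 - -Real.exp (-w ^ 2 / 2) by ring, ← hv]
  refine MeasureTheory.setIntegral_mono_on (integrable_gauss.integrableOn.const_mul w) hi
    measurableSet_Ioi fun t ht => ?_
  exact mul_le_mul_of_nonneg_right (le_of_lt ht) (Real.exp_pos _).le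

/-- The Mills ratio of the Gaussian distribution. -/
noncomputable def millsRatio (w : ℝ) : ℝ :=
  Real.exp (w ^ 2 / 2) * (Real.sqrt (2 * Real.pi) - gaussInt w)

lemma millsRatio_neg (w : ℝ) : millsRatio (-w) = Real.exp (w ^ 2 / 2) * gaussInt w := by
  rw [millsRatio, gaussInt_neg, neg_sq]
  ring

lemma millsRatio_nonneg (w : ℝ) : 0 ≤ millsRatio w :=
  mul_nonneg (Real.exp_pos _).le (sub_nonneg.2 (gaussInt_le w))

lemma mul_millsRatio_le {w : ℝ} (hw : 0 < w) : w * millsRatio w ≤ 1 := by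
  have h := mul_le_mul_of_nonneg_left (gauss_tail_mul_le hw) (Real.exp_pos (w ^ 2 / 2)).le
  rw [← Real.exp_add, show w ^ 2 / 2 + -w ^ 2 / 2 = 0 by ring, Real.exp_zero] at h
  rw [millsRatio]
  linarith

/-- A uniform bound for the Mills ratio on the positive half-line, and hence for the solutions
of Stein's equation. -/
noncomputable def steinBound : ℝ := Real.exp (1 / 2) * Real.sqrt (2 * Real.pi)

lemma steinBound_nonneg : 0 ≤ steinBound := by
  unfold steinBound
  positivity

lemma millsRatio_le {w : ℝ} (hw : 0 ≤ w) : millsRatio w ≤ steinBound := by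
  unfold steinBound
  rcases le_or_gt w 1 with h | h
  · refine mul_le_mul (Real.exp_le_exp.2 (by nlinarith)) ?_
      (sub_nonneg.2 (gaussInt_le w)) (Real.exp_pos _).le
    linarith [gaussInt_nonneg w]
  · have h1 := mul_millsRatio_le (by linarith : 0 < w)
    have h2 : 1 ≤ Real.exp (1 / 2) := Real.one_le_exp (by norm_num)
    nlinarith [one_le_sqrt_two_pi, millsRatio_nonneg w]

/-- The normalised Gaussian distribution function. -/
noncomputable def gaussCdf (x : ℝ) : ℝ := (1 / Real.sqrt (2 * Real.pi)) * gaussInt x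

lemma gaussCdf_nonneg (x : ℝ) : 0 ≤ gaussCdf x :=
  mul_nonneg (by positivity) (gaussInt_nonneg x)

lemma sqrt_mul_gaussCdf (x : ℝ) : Real.sqrt (2 * Real.pi) * gaussCdf x = gaussInt x := by
  have := one_le_sqrt_two_pi
  rw [gaussCdf]
  field_simp

lemma gaussCdf_le_one (x : ℝ) : gaussCdf x ≤ 1 := by
  have := one_le_sqrt_two_pi
  nlinarith [sqrt_mul_gaussCdf x, gaussInt_le x]

lemma gaussCdf_sub_le {x y : ℝ} (h : x ≤ y) : gaussCdf y - gaussCdf x ≤ y - x := by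
  have := one_le_sqrt_two_pi
  nlinarith [sqrt_mul_gaussCdf x, sqrt_mul_gaussCdf y, gaussInt_sub_le h]

/-- The bounded solution of Stein's equation for the half-line `(-∞, z]`. -/
noncomputable def steinSol (z w : ℝ) : ℝ :=
  Real.exp (w ^ 2 / 2) * (gaussInt (min w z) - gaussCdf z * gaussInt w)

lemma steinSol_of_le {z w : ℝ} (h : w ≤ z) :
    steinSol z w = (1 - gaussCdf z) * millsRatio (-w) := by
  rw [steinSol, min_eq_left h, millsRatio_neg]
  ring

lemma steinSol_of_ge {z w : ℝ} (h : z ≤ w) :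
    steinSol z w = gaussCdf z * millsRatio w := by
  rw [steinSol, min_eq_right h, millsRatio, ← sqrt_mul_gaussCdf z]
  ring

lemma steinSol_nonneg (z w : ℝ) : 0 ≤ steinSol z w := by
  rcases le_total w z with h | h
  · rw [steinSol_of_le h]
    exact mul_nonneg (sub_nonneg.2 (gaussCdf_le_one z)) (millsRatio_nonneg _)
  · rw [steinSol_of_ge h]
    exact mul_nonneg (gaussCdf_nonneg z) (millsRatio_nonneg _)

lemma steinSol_le_left (z w : ℝ) : steinSol z w ≤ millsRatio (-w) := by
  rw [millsRatio_neg, steinSol]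
  refine mul_le_mul_of_nonneg_left ?_ (Real.exp_pos _).le
  linarith [gaussInt_mono (min_le_left w z), mul_nonneg (gaussCdf_nonneg z) (gaussInt_nonneg w)]

lemma steinSol_le_right (z w : ℝ) : steinSol z w ≤ millsRatio w := by
  rw [millsRatio, steinSol]
  refine mul_le_mul_of_nonneg_left ?_ (Real.exp_pos _).le
  have h1 := gaussInt_mono (min_le_right w z)
  rw [← sqrt_mul_gaussCdf z] at h1
  nlinarith [mul_nonneg (sub_nonneg.2 (gaussCdf_le_one z)) (sub_nonneg.2 (gaussInt_le w))]

lemma abs_mul_steinSol_le (z w : ℝ) : |w * steinSol z w| ≤ 1 := by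
  have h0 := steinSol_nonneg z w
  rw [abs_mul, abs_of_nonneg h0]
  rcases lt_trichotomy w 0 with h | h | h
  · rw [abs_of_neg h]
    exact (mul_le_mul_of_nonneg_left (steinSol_le_left z w) (by linarith)).trans
      (mul_millsRatio_le (by linarith))
  · simp [h]
  · rw [abs_of_pos h]
    exact (mul_le_mul_of_nonneg_left (steinSol_le_right z w) h.le).trans (mul_millsRatio_le h)

lemma steinSol_le (z w : ℝ) : steinSol z w ≤ steinBound := by
  rcases le_total w 0 with h | h
  · exact (steinSol_le_left z w).trans (millsRatio_le (by linarith))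
  · exact (steinSol_le_right z w).trans (millsRatio_le h)

lemma continuous_steinSol (z : ℝ) : Continuous (steinSol z) := by
  have h : Continuous gaussInt :=
    continuous_iff_continuousAt.2 fun x => (hasDerivAt_gaussInt x).continuousAt
  unfold steinSol
  fun_prop

lemma hasDerivWithinAt_steinSol (z w : ℝ) :
    HasDerivWithinAt (steinSol z) (w * steinSol z w + ((if w < z then 1 else 0) - gaussCdf z))
      (Set.Ici w) w := by
  have hm : HasDerivWithinAt (fun w => gaussInt (min w z))
      (if w < z then Real.exp (-w ^ 2 / 2) else 0) (Set.Ici w) w := by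
    split_ifs with h
    · refine ((hasDerivAt_gaussInt w).congr_of_eventuallyEq ?_).hasDerivWithinAt
      filter_upwards [Iio_mem_nhds h] with y hy
      rw [min_eq_left (le_of_lt hy)]
    · refine (hasDerivWithinAt_const w _ (gaussInt z)).congr (fun y hy => ?_) ?_
      · rw [min_eq_right ((not_lt.1 h).trans hy)]
      · rw [min_eq_right (not_lt.1 h)]
  have he : HasDerivAt (fun w : ℝ => Real.exp (w ^ 2 / 2)) (w * Real.exp (w ^ 2 / 2)) w := by
    have := ((hasDerivAt_pow 2 w).div_const 2).exp
    refine this.congr_deriv ?_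
    simp only [Nat.cast_ofNat, Nat.add_one_sub_one, pow_one]
    ring
  have := he.hasDerivWithinAt.mul
    (hm.sub ((hasDerivAt_gaussInt w).hasDerivWithinAt.const_mul (gaussCdf z)))
  refine (this.congr_deriv ?_ : HasDerivWithinAt (steinSol z) _ _ _)
  have hx : Real.exp (w ^ 2 / 2) * Real.exp (-w ^ 2 / 2) = 1 := by
    rw [← Real.exp_add, show w ^ 2 / 2 + -w ^ 2 / 2 = 0 by ring, Real.exp_zero]
  simp only [steinSol, Pi.sub_apply]
  split_ifs
  · linear_combination (1 - gaussCdf z) * hx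
  · linear_combination (- gaussCdf z) * hx

lemma sub_le_of_right_deriv_le {f f' : ℝ → ℝ} (hf : Continuous f)
    (hf' : ∀ t, HasDerivWithinAt f (f' t) (Set.Ici t) t) {a b K : ℝ} (hab : a ≤ b)
    (hK : ∀ t ∈ Set.Ico a b, f' t ≤ K) : f b - f a ≤ K * (b - a) := by
  have hB : ∀ t, HasDerivAt (fun t => f a + K * (t - a)) K t := fun t => by
    simpa using (((hasDerivAt_id t).sub_const a).const_mul K).const_add (f a)
  have := image_le_of_deriv_right_le_deriv_boundary (a := a) (b := b) hf.continuousOn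
    (fun t _ => hf' t) (B := fun t => f a + K * (t - a)) (B' := fun _ => K) (by simp)
    (fun t _ => (hB t).continuousAt.continuousWithinAt) (fun t _ => (hB t).hasDerivWithinAt) hK
    (Set.right_mem_Icc.2 hab)
  linarith

lemma le_sub_of_le_right_deriv {f f' : ℝ → ℝ} (hf : Continuous f)
    (hf' : ∀ t, HasDerivWithinAt f (f' t) (Set.Ici t) t) {a b K : ℝ} (hab : a ≤ b)
    (hK : ∀ t ∈ Set.Ico a b, K ≤ f' t) : K * (b - a) ≤ f b - f a := by
  have := sub_le_of_right_deriv_le (f := fun t => -f t) (f' := fun t => -f' t) hf.neg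
    (fun t => (hf' t).neg) hab (K := -K) (fun t ht => neg_le_neg (hK t ht))
  linarith

lemma abs_steinSol_sub_le (z : ℝ) {a b : ℝ} (hab : a ≤ b) :
    |steinSol z b - steinSol z a| ≤ 2 * (b - a) := by
  have hb : ∀ t, |t * steinSol z t + ((if t < z then 1 else 0) - gaussCdf z)| ≤ 2 := fun t => by
    have h1 := abs_le.1 (abs_mul_steinSol_le z t)
    have h2 := gaussCdf_nonneg z
    have h3 := gaussCdf_le_one z
    rw [abs_le]
    split_ifs <;> constructor <;> linarith
  rw [abs_le]
  constructor
  · have := le_sub_of_le_right_deriv (continuous_steinSol z) (hasDerivWithinAt_steinSol z) hab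
      (K := -2) fun t _ => (abs_le.1 (hb t)).1
    linarith
  · exact sub_le_of_right_deriv_le (continuous_steinSol z) (hasDerivWithinAt_steinSol z) hab
      fun t _ => (abs_le.1 (hb t)).2

lemma abs_mul_steinSol_sub_le (z t u : ℝ) :
    |t * steinSol z t - u * steinSol z u| ≤ |t - u| * (steinBound + 2 * |u|) := by
  have h1 : |steinSol z t - steinSol z u| ≤ 2 * |t - u| := by
    rcases le_total u t with h | h
    · rw [abs_of_nonneg (sub_nonneg.2 h)]
      exact abs_steinSol_sub_le z h
    · rw [abs_sub_comm t u, abs_of_nonneg (sub_nonneg.2 h), abs_sub_comm]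
      exact abs_steinSol_sub_le z h
  have h2 : |steinSol z t| ≤ steinBound := by
    rw [abs_of_nonneg (steinSol_nonneg z t)]
    exact steinSol_le z t
  calc |t * steinSol z t - u * steinSol z u|
      = |(t - u) * steinSol z t + u * (steinSol z t - steinSol z u)| := by ring_nf
    _ ≤ |t - u| * |steinSol z t| + |u| * |steinSol z t - steinSol z u| := by
        rw [← abs_mul, ← abs_mul]
        exact abs_add_le _ _
    _ ≤ |t - u| * steinBound + |u| * (2 * |t - u|) := by gcongr
    _ = _ := by ring

lemma le_steinSol_sub (z : ℝ) {a d u : ℝ} (hd : 0 ≤ d) (hu : u ∈ Set.Icc a (a + d)) :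
    d * (u * steinSol z u - d * (steinBound + 2 * |u|)
      + ((if u ≤ z - d then 1 else 0) - gaussCdf z)) ≤ steinSol z (a + d) - steinSol z a := by
  have hB := steinBound_nonneg
  refine (le_of_eq (by ring)).trans (le_sub_of_le_right_deriv (continuous_steinSol z)
    (hasDerivWithinAt_steinSol z) (by linarith) (K := u * steinSol z u
      - d * (steinBound + 2 * |u|) + ((if u ≤ z - d then 1 else 0) - gaussCdf z)) fun t ht => ?_)
  have h1 := (abs_le.1 (abs_mul_steinSol_sub_le z t u)).1
  have h2 : |t - u| ≤ d := abs_le.2 ⟨by linarith [hu.2, ht.1], by linarith [hu.1, ht.2]⟩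
  have h3 := mul_le_mul_of_nonneg_right h2 (by positivity : 0 ≤ steinBound + 2 * |u|)
  have h4 : (if u ≤ z - d then (1 : ℝ) else 0) ≤ if t < z then 1 else 0 := by
    split_ifs with h h' h'
    · rfl
    · exact absurd (by linarith [ht.2, hu.1]) h'
    · norm_num
    · rfl
  linarith

lemma steinSol_sub_le (z : ℝ) {a d u : ℝ} (hd : 0 ≤ d) (hu : u ∈ Set.Icc a (a + d)) :
    steinSol z (a + d) - steinSol z a ≤ d * (u * steinSol z u + d * (steinBound + 2 * |u|)
      + ((if u ≤ z + d then 1 else 0) - gaussCdf z)) := by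
  have hB := steinBound_nonneg
  refine (sub_le_of_right_deriv_le (continuous_steinSol z)
    (hasDerivWithinAt_steinSol z) (by linarith) (K := u * steinSol z u
      + d * (steinBound + 2 * |u|) + ((if u ≤ z + d then 1 else 0) - gaussCdf z))
      fun t ht => ?_).trans (le_of_eq (by ring))
  have h1 := (abs_le.1 (abs_mul_steinSol_sub_le z t u)).2
  have h2 : |t - u| ≤ d := abs_le.2 ⟨by linarith [hu.2, ht.1], by linarith [hu.1, ht.2]⟩
  have h3 := mul_le_mul_of_nonneg_right h2 (by positivity : 0 ≤ steinBound + 2 * |u|)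
  have h4 : (if t < z then (1 : ℝ) else 0) ≤ if u ≤ z + d then 1 else 0 := by
    split_ifs with h h' h'
    · rfl
    · exact absurd (by linarith [ht.1, hu.2]) h'
    · norm_num
    · rfl
  linarith

/-- The expectation of `F T`, where `T` is the random subset of `s` that contains each `i ∈ s`
independently with probability `p i`. -/
noncomputable def bernMean (p : ℕ → ℝ) (s : Finset ℕ) (F : Finset ℕ → ℝ) : ℝ :=
  ∑ T ∈ s.powerset, ((∏ i ∈ T, p i) * ∏ i ∈ s \ T, (1 - p i)) * F T

lemma bernMean_insert (p : ℕ → ℝ) {s : Finset ℕ} {a : ℕ} (ha : a ∉ s) (F : Finset ℕ → ℝ) :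
    bernMean p (insert a s) F
      = (1 - p a) * bernMean p s F + p a * bernMean p s (fun T => F (insert a T)) := by
  unfold bernMean
  rw [Finset.sum_powerset_insert ha, Finset.mul_sum, Finset.mul_sum]
  congr 1
  · refine Finset.sum_congr rfl fun T hT => ?_
    have haT : a ∉ T := fun h => ha (Finset.mem_powerset.1 hT h)
    rw [Finset.insert_sdiff_of_notMem _ haT, Finset.prod_insert (by simp [ha])]
    ring
  · refine Finset.sum_congr rfl fun T hT => ?_
    have haT : a ∉ T := fun h => ha (Finset.mem_powerset.1 hT h)
    have hd : insert a s \ insert a T = s \ T := by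
      ext j
      simp only [Finset.mem_sdiff, Finset.mem_insert]
      by_cases hj : j = a
      · simp [hj, ha]
      · simp [hj]
    rw [hd, Finset.prod_insert haT]
    ring

lemma bernMean_add (p : ℕ → ℝ) (s : Finset ℕ) (F G : Finset ℕ → ℝ) :
    bernMean p s (fun T => F T + G T) = bernMean p s F + bernMean p s G := by
  simp only [bernMean, mul_add, Finset.sum_add_distrib]

lemma bernMean_const_mul (p : ℕ → ℝ) (s : Finset ℕ) (c : ℝ) (F : Finset ℕ → ℝ) :
    bernMean p s (fun T => c * F T) = c * bernMean p s F := by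
  simp only [bernMean, Finset.mul_sum]
  exact Finset.sum_congr rfl fun _ _ => by ring

lemma bernMean_sub (p : ℕ → ℝ) (s : Finset ℕ) (F G : Finset ℕ → ℝ) :
    bernMean p s (fun T => F T - G T) = bernMean p s F - bernMean p s G := by
  simp only [bernMean, mul_sub, Finset.sum_sub_distrib]

lemma bernMean_const (p : ℕ → ℝ) (s : Finset ℕ) (c : ℝ) : bernMean p s (fun _ => c) = c := by
  rw [bernMean, ← Finset.sum_mul, ← Finset.prod_add]
  simp

lemma bernMean_mono {p : ℕ → ℝ} {s : Finset ℕ} (h0 : ∀ i ∈ s, 0 ≤ p i) (h1 : ∀ i ∈ s, p i ≤ 1)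
    {F G : Finset ℕ → ℝ} (h : ∀ T ⊆ s, F T ≤ G T) : bernMean p s F ≤ bernMean p s G := by
  refine Finset.sum_le_sum fun T hT => ?_
  rw [Finset.mem_powerset] at hT
  refine mul_le_mul_of_nonneg_left (h T hT) (mul_nonneg ?_ ?_)
  · exact Finset.prod_nonneg fun i hi => h0 i (hT hi)
  · exact Finset.prod_nonneg fun i hi => sub_nonneg.2 (h1 i (Finset.mem_sdiff.1 hi).1)

lemma bernMean_sum {ι : Type*} (p : ℕ → ℝ) (s : Finset ℕ) (u : Finset ι)
    (F : ι → Finset ℕ → ℝ) :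
    bernMean p s (fun T => ∑ i ∈ u, F i T) = ∑ i ∈ u, bernMean p s (F i) := by
  simp only [bernMean, Finset.mul_sum]
  exact Finset.sum_comm

lemma bernMean_congr {p : ℕ → ℝ} {s : Finset ℕ} {F G : Finset ℕ → ℝ} (h : ∀ T ⊆ s, F T = G T) :
    bernMean p s F = bernMean p s G :=
  Finset.sum_congr rfl fun T hT => by rw [h T (Finset.mem_powerset.1 hT)]

/-- The zero-bias identity for one Bernoulli summand. -/
lemma bernMean_indicator_sub_mul (p : ℕ → ℝ) {s : Finset ℕ} {i : ℕ} (hi : i ∈ s) (g : ℕ → ℝ) :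
    bernMean p s (fun T => ((if i ∈ T then 1 else 0) - p i) * g T.card)
      = p i * (1 - p i) * bernMean p (s.erase i) (fun T => g (T.card + 1) - g T.card) := by
  have hn : i ∉ s.erase i := Finset.notMem_erase i s
  have hT : ∀ T ⊆ s.erase i, i ∉ T := fun T hT h => hn (hT h)
  conv_lhs => rw [← Finset.insert_erase hi]
  rw [bernMean_insert p hn, bernMean_sub,
    bernMean_congr (G := fun T => (-p i) * g T.card) fun T h => by simp [hT T h],
    bernMean_congr (F := fun T => _ * g (insert i T).card)
      (G := fun T => (1 - p i) * g (T.card + 1)) fun T h => by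
        simp [Finset.card_insert_of_notMem (hT T h)],
    bernMean_const_mul, bernMean_const_mul]
  ring

/-- The zero-bias identity for a sum of independent Bernoulli variables. -/
lemma bernMean_card_sub_mul (p : ℕ → ℝ) (s : Finset ℕ) (g : ℕ → ℝ) :
    bernMean p s (fun T => ((T.card : ℝ) - ∑ i ∈ s, p i) * g T.card)
      = ∑ i ∈ s, p i * (1 - p i) *
          bernMean p (s.erase i) (fun T => g (T.card + 1) - g T.card) := by
  rw [← Finset.sum_congr rfl fun i hi => bernMean_indicator_sub_mul p hi g, ← bernMean_sum]
  refine bernMean_congr fun T hT => ?_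
  rw [← Finset.sum_mul, Finset.sum_sub_distrib, Finset.sum_ite_mem,
    Finset.inter_eq_right.2 hT]
  simp

lemma bernMean_le_erase {p : ℕ → ℝ} {s : Finset ℕ} (h0 : ∀ i ∈ s, 0 ≤ p i)
    (h1 : ∀ i ∈ s, p i ≤ 1) {i : ℕ} (hi : i ∈ s) {F h : ℕ → ℝ}
    (hF : ∀ k, F k ≤ h k) (hF' : ∀ k, F (k + 1) ≤ h k) :
    bernMean p s (fun T => F T.card) ≤ bernMean p (s.erase i) (fun T => h T.card) := by
  have hn : i ∉ s.erase i := Finset.notMem_erase i s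
  conv_lhs => rw [← Finset.insert_erase hi]
  rw [bernMean_insert p hn]
  have g0 : ∀ j ∈ s.erase i, 0 ≤ p j := fun j hj => h0 j (Finset.mem_of_mem_erase hj)
  have g1 : ∀ j ∈ s.erase i, p j ≤ 1 := fun j hj => h1 j (Finset.mem_of_mem_erase hj)
  have e1 : bernMean p (s.erase i) (fun T => F T.card)
      ≤ bernMean p (s.erase i) (fun T => h T.card) := bernMean_mono g0 g1 fun T _ => hF _
  have e2 : bernMean p (s.erase i) (fun T => F (insert i T).card)
      ≤ bernMean p (s.erase i) (fun T => h T.card) := bernMean_mono g0 g1 fun T hT => by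
    rw [Finset.card_insert_of_notMem fun h' => hn (hT h')]
    exact hF' _
  have := mul_le_mul_of_nonneg_left e1 (sub_nonneg.2 (h1 i hi))
  have := mul_le_mul_of_nonneg_left e2 (h0 i hi)
  linarith

lemma mul_bernMean_le {p : ℕ → ℝ} {s : Finset ℕ} (h0 : ∀ i ∈ s, 0 ≤ p i)
    (h1 : ∀ i ∈ s, p i ≤ 1) {F g : ℕ → ℝ}
    (hF : ∀ k, F k ≤ g (k + 1) - g k) (hF' : ∀ k, F (k + 1) ≤ g (k + 1) - g k) :
    (∑ i ∈ s, p i * (1 - p i)) * bernMean p s (fun T => F T.card)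
      ≤ bernMean p s (fun T => ((T.card : ℝ) - ∑ i ∈ s, p i) * g T.card) := by
  rw [bernMean_card_sub_mul, Finset.sum_mul]
  exact Finset.sum_le_sum fun i hi => mul_le_mul_of_nonneg_left
    (bernMean_le_erase h0 h1 hi hF hF') (mul_nonneg (h0 i hi) (sub_nonneg.2 (h1 i hi)))

lemma bernMean_variance (p : ℕ → ℝ) (s : Finset ℕ) :
    bernMean p s (fun T => ((T.card : ℝ) - ∑ i ∈ s, p i) ^ 2) = ∑ i ∈ s, p i * (1 - p i) := by
  have := bernMean_card_sub_mul p s (fun k => (k : ℝ) - ∑ i ∈ s, p i)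
  simp only [← sq] at this
  rw [this]
  refine Finset.sum_congr rfl fun i _ => ?_
  rw [bernMean_congr (G := fun _ => 1) fun T _ => by push_cast; ring, bernMean_const, mul_one]

section Stein

variable {p : ℕ → ℝ} {s : Finset ℕ} {v : ℝ}

lemma bernMean_abs_le (h0 : ∀ i ∈ s, 0 ≤ p i) (h1 : ∀ i ∈ s, p i ≤ 1) (hv : 0 < v)
    (hV : ∑ i ∈ s, p i * (1 - p i) = v ^ 2) :
    bernMean p s (fun T => |((T.card : ℝ) - ∑ i ∈ s, p i) / v|) ≤ 1 := by
  have h : bernMean p s (fun T => |((T.card : ℝ) - ∑ i ∈ s, p i) / v|)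
      ≤ bernMean p s (fun T => 1 / 2 + 1 / (2 * v ^ 2) * ((T.card : ℝ) - ∑ i ∈ s, p i) ^ 2) :=
    bernMean_mono h0 h1 fun T _ => by
      have e : 1 / (2 * v ^ 2) * ((T.card : ℝ) - ∑ i ∈ s, p i) ^ 2
          = |((T.card : ℝ) - ∑ i ∈ s, p i) / v| ^ 2 / 2 := by
        rw [sq_abs]
        field_simp
      rw [e]
      nlinarith [sq_nonneg (|((T.card : ℝ) - ∑ i ∈ s, p i) / v| - 1)]
  rw [bernMean_add, bernMean_const, bernMean_const_mul, bernMean_variance, hV] at h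
  refine h.trans (le_of_eq ?_)
  field_simp
  norm_num

lemma bernMean_le_gaussCdf (h0 : ∀ i ∈ s, 0 ≤ p i) (h1 : ∀ i ∈ s, p i ≤ 1) (hv : 0 < v)
    (hV : ∑ i ∈ s, p i * (1 - p i) = v ^ 2) (z : ℝ) :
    bernMean p s (fun T => if ((T.card : ℝ) - ∑ i ∈ s, p i) / v ≤ z - 1 / v then 1 else 0)
      ≤ gaussCdf z + (steinBound + 2) * (1 / v) := by
  have hd : 0 < 1 / v := by positivity
  set m := ∑ i ∈ s, p i with hm
  set W : ℕ → ℝ := fun k => ((k : ℝ) - m) / v with hW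
  have hW1 : ∀ k : ℕ, W (k + 1) = W k + 1 / v := fun k => by simp only [hW]; push_cast; ring
  have key := mul_bernMean_le h0 h1 (g := fun k => steinSol z (W k))
    (F := fun k => 1 / v * (W k * steinSol z (W k) - 1 / v * (steinBound + 2 * |W k|)
      + ((if W k ≤ z - 1 / v then 1 else 0) - gaussCdf z)))
    (fun k => by
      rw [hW1 k]
      exact le_steinSol_sub z hd.le ⟨le_rfl, by linarith⟩)
    (fun k => by
      have := le_steinSol_sub z hd.le (a := W k) (u := W (k + 1)) ⟨by linarith [hW1 k], (hW1 k).le⟩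
      rwa [← hW1 k] at this)
  rw [bernMean_const_mul, bernMean_add, bernMean_sub, bernMean_sub, bernMean_const,
    bernMean_const_mul, bernMean_add, bernMean_const_mul, bernMean_const, hV, ← hm,
    bernMean_congr (F := fun T => ((T.card : ℝ) - m) * steinSol z (W T.card))
      (G := fun T => v * (W T.card * steinSol z (W T.card))) fun T _ => by
        simp only [hW]; field_simp, bernMean_const_mul,
    ← mul_assoc, show v ^ 2 * (1 / v) = v by field_simp] at key
  have key := le_of_mul_le_mul_left key hv
  have hA := mul_le_mul_of_nonneg_left (bernMean_abs_le h0 h1 hv hV) hd.le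
  change 1 / v * bernMean p s (fun T => |W T.card|) ≤ _ at hA
  change bernMean p s (fun T => if W T.card ≤ z - 1 / v then 1 else 0) ≤ _
  linarith

lemma gaussCdf_le_bernMean (h0 : ∀ i ∈ s, 0 ≤ p i) (h1 : ∀ i ∈ s, p i ≤ 1) (hv : 0 < v)
    (hV : ∑ i ∈ s, p i * (1 - p i) = v ^ 2) (z : ℝ) :
    gaussCdf z - (steinBound + 2) * (1 / v) ≤
      bernMean p s (fun T => if ((T.card : ℝ) - ∑ i ∈ s, p i) / v ≤ z + 1 / v then 1 else 0) := by
  have hd : 0 < 1 / v := by positivity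
  set m := ∑ i ∈ s, p i with hm
  set W : ℕ → ℝ := fun k => ((k : ℝ) - m) / v with hW
  have hW1 : ∀ k : ℕ, W (k + 1) = W k + 1 / v := fun k => by simp only [hW]; push_cast; ring
  have key := mul_bernMean_le h0 h1 (g := fun k => -steinSol z (W k))
    (F := fun k => -(1 / v) * (W k * steinSol z (W k) + 1 / v * (steinBound + 2 * |W k|)
      + ((if W k ≤ z + 1 / v then 1 else 0) - gaussCdf z)))
    (fun k => by
      have := steinSol_sub_le z hd.le (a := W k) (u := W k) ⟨le_rfl, by linarith⟩
      rw [hW1 k]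
      linarith)
    (fun k => by
      have := steinSol_sub_le z hd.le (a := W k) (u := W (k + 1))
        ⟨by linarith [hW1 k], (hW1 k).le⟩
      rw [← hW1 k] at this
      linarith)
  rw [bernMean_const_mul, bernMean_add, bernMean_add, bernMean_sub, bernMean_const,
    bernMean_const_mul, bernMean_add, bernMean_const_mul, bernMean_const, hV, ← hm,
    bernMean_congr (F := fun T => ((T.card : ℝ) - m) * -steinSol z (W T.card))
      (G := fun T => (-v) * (W T.card * steinSol z (W T.card))) fun T _ => by
        simp only [hW]; field_simp, bernMean_const_mul,
    ← mul_assoc, show v ^ 2 * -(1 / v) = -v by field_simp, neg_mul, neg_mul, neg_le_neg_iff] at key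
  have key := le_of_mul_le_mul_left key hv
  have hA := mul_le_mul_of_nonneg_left (bernMean_abs_le h0 h1 hv hV) hd.le
  change 1 / v * bernMean p s (fun T => |W T.card|) ≤ _ at hA
  change _ ≤ bernMean p s (fun T => if W T.card ≤ z + 1 / v then 1 else 0)
  linarith

/-- The Berry–Esseen bound for a sum of independent Bernoulli variables. -/
theorem abs_bernMean_sub_gaussCdf_le (h0 : ∀ i ∈ s, 0 ≤ p i) (h1 : ∀ i ∈ s, p i ≤ 1)
    (hv : 0 < v) (hV : ∑ i ∈ s, p i * (1 - p i) = v ^ 2) (x : ℝ) :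
    |bernMean p s (fun T => if ((T.card : ℝ) - ∑ i ∈ s, p i) / v ≤ x then 1 else 0)
      - gaussCdf x| ≤ (steinBound + 3) * (1 / v) := by
  have hd : 0 < 1 / v := by positivity
  have u := bernMean_le_gaussCdf h0 h1 hv hV (x + 1 / v)
  have l := gaussCdf_le_bernMean h0 h1 hv hV (x - 1 / v)
  rw [add_sub_cancel_right] at u
  rw [sub_add_cancel] at l
  have u' := gaussCdf_sub_le (x := x) (y := x + 1 / v) (by linarith)
  have l' := gaussCdf_sub_le (x := x - 1 / v) (y := x) (by linarith)
  rw [abs_le]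
  constructor <;> linarith

end Stein

lemma polyP_succ_succ {h : ℕ → ℝ} (h0 : ∀ n, 0 < n → 0 < h n) (m : ℕ) :
    polyP h (m + 2) = Polynomial.C ((1 + h (m + 1)) / h (m + 2)) *
      ((Polynomial.C (1 / (1 + h (m + 1))) * Polynomial.X
        + Polynomial.C (1 - 1 / (1 + h (m + 1)))) * polyP h (m + 1)) := by
  have e1 := h0 (m + 1) m.succ_pos
  have hs : polyP h (m + 1) * Polynomial.C (h (m + 1))
      = Polynomial.X * ∑ k : Fin (m + 1), polyP h k := by
    rw [polyP, mul_comm, ← mul_assoc, ← mul_assoc, ← Polynomial.C_mul, mul_one_div_cancel e1.ne']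
    simp
  have c1 : Polynomial.C ((1 + h (m + 1)) / h (m + 2)) * Polynomial.C (1 / (1 + h (m + 1)))
      = Polynomial.C (1 / h (m + 2)) := by
    rw [← Polynomial.C_mul]
    congr 1
    field_simp
  have c2 : Polynomial.C ((1 + h (m + 1)) / h (m + 2)) * Polynomial.C (1 - 1 / (1 + h (m + 1)))
      = Polynomial.C (1 / h (m + 2)) * Polynomial.C (h (m + 1)) := by
    rw [← Polynomial.C_mul, ← Polynomial.C_mul]
    congr 1
    field_simp
    ring
  rw [polyP, Fin.sum_univ_castSucc]
  simp only [Fin.val_castSucc, Fin.val_last]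
  linear_combination -(Polynomial.C (1 / h (m + 2))) * hs
    - Polynomial.X * polyP h (m + 1) * c1 - polyP h (m + 1) * c2

lemma polyP_eq_prod {h : ℕ → ℝ} (h0 : ∀ n, 0 < n → 0 < h n) (m : ℕ) :
    ∃ c : ℝ, c ≠ 0 ∧ polyP h (m + 1) = Polynomial.C c * Polynomial.X *
      ∏ k ∈ Finset.Ico 1 (m + 1), (Polynomial.C (1 / (1 + h k)) * Polynomial.X
        + Polynomial.C (1 - 1 / (1 + h k))) := by
  induction m with
  | zero =>
    refine ⟨1 / h 1, (one_div_pos.2 (h0 1 one_pos)).ne', ?_⟩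
    rw [polyP]
    simp [polyP]
  | succ m ih =>
    obtain ⟨c, hc, e⟩ := ih
    have e1 := h0 (m + 1) m.succ_pos
    have e2 := h0 (m + 2) (m + 1).succ_pos
    refine ⟨(1 + h (m + 1)) / h (m + 2) * c, by positivity, ?_⟩
    rw [polyP_succ_succ h0, e, Finset.prod_Ico_succ_top (show 1 ≤ m + 1 by omega), Polynomial.C_mul]
    ring

lemma sum_coeff_polyP {h : ℕ → ℝ} (h0 : ∀ n, 0 < n → 0 < h n) (m : ℕ) (q : ℕ → Prop)
    [DecidablePred q] :
    1 / (polyP h (m + 1)).eval 1 *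
        ∑ k ∈ (Finset.range (m + 1 + 1)).filter q, (polyP h (m + 1)).coeff k
      = bernMean (fun k => 1 / (1 + h k)) (Finset.Ico 1 (m + 1))
          (fun T => if q (T.card + 1) then 1 else 0) := by
  obtain ⟨c, hc, e⟩ := polyP_eq_prod h0 m
  have hev : (polyP h (m + 1)).eval 1 = c := by
    rw [e]
    simp [Polynomial.eval_prod]
  have hco : ∀ k, (polyP h (m + 1)).coeff k = c * bernMean (fun k => 1 / (1 + h k))
      (Finset.Ico 1 (m + 1)) (fun T => if k = T.card + 1 then 1 else 0) := fun k => by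
    rw [e, Finset.prod_add, bernMean, mul_assoc, Polynomial.coeff_C_mul, Finset.mul_sum,
      Polynomial.finsetSum_coeff]
    congr 1
    refine Finset.sum_congr rfl fun T _ => ?_
    rw [Finset.prod_mul_distrib, Finset.prod_const, ← map_prod, ← map_prod,
      show Polynomial.X * (Polynomial.C (∏ k ∈ T, 1 / (1 + h k)) * Polynomial.X ^ T.card *
        Polynomial.C (∏ k ∈ Finset.Ico 1 (m + 1) \ T, (1 - 1 / (1 + h k))))
        = Polynomial.C (∏ k ∈ T, 1 / (1 + h k)) *
        Polynomial.C (∏ k ∈ Finset.Ico 1 (m + 1) \ T, (1 - 1 / (1 + h k)))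
          * Polynomial.X ^ (T.card + 1) by ring, ← Polynomial.C_mul, Polynomial.coeff_C_mul_X_pow,
      mul_ite, mul_one, mul_zero]
  simp only [hev, hco]
  rw [← Finset.mul_sum, ← mul_assoc, one_div_mul_cancel hc, one_mul, ← bernMean_sum]
  refine bernMean_congr fun T hT => ?_
  rw [Finset.sum_ite_eq']
  have hcard := Finset.card_le_card hT
  rw [Nat.card_Ico] at hcard
  simp only [Finset.mem_filter, Finset.mem_range]
  congr 1
  exact propext ⟨fun h => h.2, fun h => ⟨by omega, h⟩⟩

lemma tendsto_sigmaN {s : ℝ} (hs : s ∈ Set.Icc (0 : ℝ) 1) :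
    Filter.Tendsto (fun n : ℕ => sigmaN s n) Filter.atTop Filter.atTop := by
  refine Real.tendsto_sqrt_atTop.comp ?_
  rw [← Filter.tendsto_add_atTop_iff_nat 1]
  refine Filter.tendsto_atTop_mono (fun n => ?_)
    (Real.tendsto_sum_range_one_div_nat_succ_atTop.atTop_div_const (by norm_num : (0 : ℝ) < 4))
  rw [Finset.sum_Ico_eq_sum_range, Finset.sum_div]
  refine Finset.sum_le_sum fun i _ => ?_
  have hi : (1 : ℝ) ≤ ((1 + i : ℕ) : ℝ) := by push_cast; linarith [i.cast_nonneg (α := ℝ)]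
  set y := ((1 + i : ℕ) : ℝ) with hy
  have hy' : (i : ℝ) + 1 = y := by rw [hy]; push_cast; ring
  have h1 : 1 ≤ y ^ s := Real.one_le_rpow hi hs.1
  have h2 : y ^ s ≤ y := by simpa using Real.rpow_le_rpow_of_exponent_le hi hs.2
  rw [hy', div_div, div_le_div_iff₀ (by positivity) (by positivity)]
  nlinarith [mul_le_mul_of_nonneg_left h2 (by positivity : 0 ≤ y ^ s)]

theorem theorem2 :
    (∃ C : ℝ, 0 < C ∧ ∀ s : ℝ, s ∈ Set.Icc (0 : ℝ) 1 → ∀ n : ℕ, 2 ≤ n → ∀ x : ℝ,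
      |(1 / (polyP (hPow s) n).eval 1) *
            ∑ k ∈ (Finset.range (n + 1)).filter
              (fun k : ℕ => (k : ℝ) ≤ muN s n + x * sigmaN s n), coeffA s n k
          - (1 / Real.sqrt (2 * Real.pi)) * ∫ t in Set.Iic x, Real.exp (-t ^ 2 / 2)|
        ≤ C * (1 / sigmaN s n)) ∧
    (∀ s : ℝ, s ∈ Set.Icc (0 : ℝ) 1 →
      Filter.Tendsto (fun n : ℕ => sigmaN s n) Filter.atTop Filter.atTop) := by
  refine ⟨⟨steinBound + 3, by linarith [steinBound_nonneg], fun s hs n hn x => ?_⟩,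
    fun s hs => tendsto_sigmaN hs⟩
  obtain ⟨m, rfl⟩ : ∃ m, n = m + 1 := ⟨n - 1, by omega⟩
  have hpos : ∀ k : ℕ, 0 < k → 0 < hPow s k := fun k hk =>
    Real.rpow_pos_of_pos (Nat.cast_pos.2 hk) s
  have hI : ∀ k ∈ Finset.Ico 1 (m + 1), 0 < hPow s k := fun k hk =>
    hpos k (Finset.mem_Ico.1 hk).1
  have hS : 0 < ∑ k ∈ Finset.Ico 1 (m + 1), (k : ℝ) ^ s / (1 + (k : ℝ) ^ s) ^ 2 :=
    Finset.sum_pos (fun k hk => by have : 0 < (k : ℝ) ^ s := hI k hk; positivity)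
      ⟨1, Finset.mem_Ico.2 ⟨le_rfl, hn⟩⟩
  have hv : 0 < sigmaN s (m + 1) := Real.sqrt_pos.2 hS
  have hV : ∑ k ∈ Finset.Ico 1 (m + 1), 1 / (1 + hPow s k) * (1 - 1 / (1 + hPow s k))
      = sigmaN s (m + 1) ^ 2 := by
    rw [sigmaN, Real.sq_sqrt hS.le]
    refine Finset.sum_congr rfl fun k hk => ?_
    have := hI k hk
    change _ = hPow s k / (1 + hPow s k) ^ 2
    field_simp
    ring
  have key := abs_bernMean_sub_gaussCdf_le (s := Finset.Ico 1 (m + 1))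
    (p := fun k => 1 / (1 + hPow s k))
    (fun k hk => by have := hI k hk; positivity)
    (fun k hk => by
      have := hI k hk
      rw [div_le_one (by positivity)]
      linarith) hv hV x
  have hsum := sum_coeff_polyP hpos m (fun k : ℕ => (k : ℝ) ≤ muN s (m + 1) + x * sigmaN s (m + 1))
  change |1 / (polyP (hPow s) (m + 1)).eval 1 * ∑ k ∈ (Finset.range (m + 1 + 1)).filter
    (fun k : ℕ => (k : ℝ) ≤ muN s (m + 1) + x * sigmaN s (m + 1)),
      (polyP (hPow s) (m + 1)).coeff k - gaussCdf x| ≤ _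
  rw [hsum]
  convert key using 4
  ext T
  congr 1
  rw [div_le_iff₀ hv, muN]
  push_cast
  refine propext ⟨fun h => ?_, fun h => ?_⟩ <;> simp only [hPow] at * <;> linarith
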